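/- For $Z\in\mathbb M_n$ (complex $n\times n$ matrices) let $\Re Z=\frac{Z+Z^*}{2}$, $\Im Z=\frac{Z-Z^*}{2i}$, $|Z|=(Z^*Z)^{1/2}$, and let $$|Z|_{\mathrm{qsym}}=\sqrt{(\Re Z)^2+(\Im Z)^2}=\Bigl(\tfrac{|Z|^2+|Z^*|^2}{2}\Bigr)^{1/2}$$ be the quadratic symmetric modulus. Let $\|X\|_p=(\operatorname{tr}|X|^p)^{1/p}$ for $1\le p<\infty$ be the Schatten $p$-norm, and let $\|X\|_\infty$ be the operator norm. Let $1\le p\le\infty$ (with $1/\infty=0$). For all $m$, $n$ and all $A_1,\dots,A_m\in\mathbb M_n$, $$\Bigl\|\sum_{k=1}^m A_k\Bigr\|_p\le\Bigl\|\sum_{k=1}^m|A_k|_{\mathrm{qsym}}\Bigr\|_p\quad\text{if }1\le p\le 2,$$ $$\Bigl\|\sum_{k=1}^m A_k\Bigr\|_p\le 2^{\frac12-\frac1p}\Bigl\|\sum_{k=1}^m|A_k|_{\mathrm{qsym}}\Bigr\|_p\quad\text{if }2\le p\le\infty.$$ Moreover, the constants $1$ and $2^{\frac12-\frac1p}$ are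 sharp: if $1\le p\le 2$, then for every $m\ge1$ and $n\ge1$ no constant $c<1$ satisfies $\|\sum_k A_k\|_p\le c\,\|\sum_k|A_k|_{\mathrm{qsym}}\|_p$ for all $A_1,\dots,A_m\in\mathbb M_n$; and if $2\le p\le\infty$, then for every $m\ge1$ and $n\ge2$ no constant $c<2^{\frac12-\frac1p}$ does. -/

import Mathlib

open scoped ENNReal MatrixOrder ComplexStarModule

noncomputable section

/-- The quadratic symmetric modulus `|Z|_qsym = √((Re Z)² + (Im Z)²)` of a complex square matrix,
where `Re Z = (Z + Z*) / 2` and `Im Z = (Z - Z*) / (2i)`, and the root is the positive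
semidefinite square root. -/
def qsymModulus {n : ℕ} (Z : Matrix (Fin n) (Fin n) ℂ) : Matrix (Fin n) (Fin n) ℂ :=
  CFC.sqrt ((ℜ Z : Matrix (Fin n) (Fin n) ℂ) ^ 2 + (ℑ Z : Matrix (Fin n) (Fin n) ℂ) ^ 2)

/-- The Schatten `p`-norm: `(tr |X|^p)^(1/p)` with `|X| = (X* X)^(1/2)` for finite `p`, and
the operator norm on Euclidean space for `p = ∞`. It is used for `1 ≤ p ≤ ∞` only. The trace of
the positive semidefinite matrix `|X|^p` is real, so taking its real part loses nothing. -/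
def schattenNorm {n : ℕ} (p : ℝ≥0∞) (X : Matrix (Fin n) (Fin n) ℂ) : ℝ :=
  if p = ∞ then ‖Matrix.toEuclideanCLM (n := Fin n) (𝕜 := ℂ) X‖
  else ((CFC.abs X ^ p.toReal).trace.re) ^ (1 / p.toReal)

end

/-! The heart of the matter is the pairing inequality Re tr A*B ≤ tr(|A|_qsym |B|_qsym)
(`re_trace_conjTranspose_mul_le_qsymModulus`). The left side is tr(Re A Re B + Im A Im B), so it is
a case of a trace Cauchy–Schwarz inequality: for Hermitian families with S² = ∑ aᵢ² and T² = ∑ bᵢ²,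
Re tr ∑ aᵢbᵢ ≤ tr ST. To see this, let K be the map X ↦ ∑ aᵢ X bᵢ, self-adjoint for the
Hilbert–Schmidt product. Ordinary Cauchy–Schwarz bounds Re⟨Z, KW⟩ by (‖SZ‖² + ‖WT‖²)/2. Left
multiplication by S and right multiplication by T commute, and this forces K ≤ L_S R_T: for
invertible weights, L_S⁻¹ K R_T⁻¹ is a contraction similar to the Hermitian (L_S R_T)^(-1/2) K (L_S
R_T)^(-1/2), whose eigenvalues are therefore at most 1. Evaluating at the identity gives the claim.

The pairing is linear in the first argument, so it can be summed over the Aₖ. Hölder and duality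
then leave only a comparison of |B|_qsym with B in the conjugate exponent q
(`tracePow_sum_le_of_dual`). Since |B|_qsym² is the mean of B*B and BB*, which have the same
spectrum, this concerns tr(X + Y)^(q/2): convexity gives constant 1 for q ≥ 2, and Rotfel'd
subadditivity gives the power of 2 for q < 2. The endpoints p = 1 and p = ∞ follow by limits. The
identity and a nilpotent matrix unit show sharpness. -/

section

open Matrix
open scoped ComplexOrder Kronecker

/-! ### Hermitian forms dominated by a geometric mean of weights -/

/-- If a Hermitian form `K` is controlled off the diagonal by `(‖l z‖² + ‖r w‖²) / 2` with positive
weights `l`, `r`, then `K` is bounded by the geometric mean `l r`. -/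
theorem Matrix.IsHermitian.re_form_le_of_pos {ι : Type*} [Fintype ι] [DecidableEq ι]
    {K : Matrix ι ι ℂ} (hK : K.IsHermitian) {l r : ι → ℝ} (hl : ∀ i, 0 < l i) (hr : ∀ i, 0 < r i)
    (h : ∀ z w : ι → ℂ, (star z ⬝ᵥ K *ᵥ w).re ≤
      (∑ i, l i ^ 2 * ‖z i‖ ^ 2 + ∑ i, r i ^ 2 * ‖w i‖ ^ 2) / 2) (x : ι → ℂ) :
    (star x ⬝ᵥ K *ᵥ x).re ≤ ∑ i, l i * r i * ‖x i‖ ^ 2 := by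
  have hlr : ∀ i, 0 < l i * r i := fun i => mul_pos (hl i) (hr i)
  set N : ι → ℝ := fun i => √(l i * r i) with hN
  have hNpos : ∀ i, 0 < N i := fun i => Real.sqrt_pos.2 (hlr i)
  have hNsq : ∀ i, N i ^ 2 = l i * r i := fun i => Real.sq_sqrt (hlr i).le
  have hN0 : ∀ i, (N i : ℂ) ≠ 0 := fun i => by exact_mod_cast (hNpos i).ne'
  set D : Matrix ι ι ℂ := diagonal fun i => ((N i)⁻¹ : ℂ) with hD
  have hDH : Dᴴ = D := by
    rw [hD, diagonal_conjTranspose]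
    congr 1; ext i; simp
  have hKD : (D * K * D).IsHermitian := by
    have := isHermitian_conjTranspose_mul_mul D hK
    rwa [hDH] at this
  have hpsd : (1 - D * K * D).PosSemidef := by
    have hH : (1 - D * K * D).IsHermitian := isHermitian_one.sub hKD
    rw [hH.posSemidef_iff_eigenvalues_nonneg]
    intro j
    change 0 ≤ hH.eigenvalues j
    set μ := hH.eigenvalues j
    set y : ι → ℂ := ⇑(hH.eigenvectorBasis j) with hy
    have hey : (1 - D * K * D) *ᵥ y = μ • y := hH.mulVec_eigenvectorBasis j
    have hev : (D * K * D) *ᵥ y = ((1 - μ : ℝ) : ℂ) • y := by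
      rw [sub_mulVec, one_mulVec] at hey
      have : (D * K * D) *ᵥ y = y - μ • y := by rw [← hey]; abel
      rw [this]; ext i; simp; ring
    have hKy : ∀ i, (K *ᵥ (D *ᵥ y)) i = (1 - μ : ℝ) * N i * y i := by
      intro i
      have h1 := congrFun hev i
      rw [← mulVec_mulVec, ← mulVec_mulVec, hD, mulVec_diagonal, ← hD] at h1
      simp only [Pi.smul_apply, smul_eq_mul] at h1
      rw [mul_right_comm, ← h1, mul_comm _ (N i : ℂ), mul_inv_cancel_left₀ (hN0 i)]
    -- With w = D y one has K w = (1 - μ) N y. The factor r / (l N) in z makes both quadratic sums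
    -- and the coefficient of 1 - μ in the pairing equal to the same c = ∑ (r / l) |y|², so the
    -- hypothesis reads (1 - μ) c ≤ c.
    have key := h (fun i => (r i / l i / N i : ℝ) * y i) (D *ᵥ y)
    set c := ∑ i, r i / l i * ‖y i‖ ^ 2 with hc
    have e1 : (star (fun i => ((r i / l i / N i : ℝ) : ℂ) * y i) ⬝ᵥ K *ᵥ (D *ᵥ y)).re
        = (1 - μ) * c := by
      rw [dotProduct, hc, Finset.mul_sum, Complex.re_sum]
      refine Finset.sum_congr rfl fun i _ => ?_
      rw [hKy]
      have : star (fun i => ((r i / l i / N i : ℝ) : ℂ) * y i) i * (((1 - μ : ℝ) : ℂ) * N i * y i)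
          = (((1 - μ) * (r i / l i * ‖y i‖ ^ 2) : ℝ) : ℂ) := by
        simp only [Pi.star_apply, star_mul', RCLike.star_def, Complex.conj_ofReal]
        have e := Complex.conj_mul' (y i)
        push_cast
        rw [← e]
        field_simp [hN0 i]
      rw [this, Complex.ofReal_re]
    have e2 : ∑ i, l i ^ 2 * ‖((r i / l i / N i : ℝ) : ℂ) * y i‖ ^ 2 = c := by
      refine Finset.sum_congr rfl fun i _ => ?_
      rw [norm_mul, Complex.norm_real, Real.norm_eq_abs, mul_pow, sq_abs, div_pow, hNsq]
      have := (hl i).ne'; have := (hr i).ne'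
      field_simp
    have e3 : ∑ i, r i ^ 2 * ‖(D *ᵥ y) i‖ ^ 2 = c := by
      refine Finset.sum_congr rfl fun i _ => ?_
      rw [hD, mulVec_diagonal, norm_mul, norm_inv, Complex.norm_real, Real.norm_eq_abs, mul_pow,
        inv_pow, sq_abs, hNsq]
      have := (hl i).ne'; have := (hr i).ne'
      field_simp
    rw [e1, e2, e3] at key
    have hcpos : 0 < c := by
      have hy0 : y ≠ 0 := fun h0 => hH.eigenvectorBasis.orthonormal.ne_zero j
        ((WithLp.ofLp_eq_zero 2).1 h0)
      obtain ⟨i, hi⟩ := Function.ne_iff.1 hy0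
      refine Finset.sum_pos' (fun i _ => ?_) ⟨i, Finset.mem_univ _, ?_⟩
      · exact mul_nonneg (div_pos (hr i) (hl i)).le (sq_nonneg _)
      · exact mul_pos (div_pos (hr i) (hl i)) (pow_pos (norm_pos_iff.2 hi) 2)
    nlinarith
  have h0 := hpsd.re_dotProduct_nonneg (fun i => (N i : ℂ) * x i)
  have hDx : D *ᵥ (fun i => (N i : ℂ) * x i) = x := by
    ext i
    rw [hD, mulVec_diagonal, inv_mul_cancel_left₀ (hN0 i)]
  have hxD : star (fun i => (N i : ℂ) * x i) ᵥ* D = star x := by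
    rw [← hDH, ← star_mulVec, hDx]
  rw [sub_mulVec, one_mulVec, dotProduct_sub, mul_assoc, ← mulVec_mulVec, ← mulVec_mulVec, hDx,
    dotProduct_mulVec _ D, hxD, map_sub, sub_nonneg] at h0
  refine h0.trans (le_of_eq ?_)
  rw [dotProduct]
  simp only [map_sum]
  refine Finset.sum_congr rfl fun i _ => ?_
  have : star (fun i => (N i : ℂ) * x i) i * ((N i : ℂ) * x i)
      = ((l i * r i * ‖x i‖ ^ 2 : ℝ) : ℂ) := by
    rw [← hNsq]
    simp only [Pi.star_apply, star_mul', RCLike.star_def, Complex.conj_ofReal]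
    push_cast
    rw [← Complex.conj_mul' (x i)]; ring
  rw [this]; exact Complex.ofReal_re _

/-- The version of `Matrix.IsHermitian.re_form_le_of_pos` for nonnegative weights. -/
theorem Matrix.IsHermitian.re_form_le {ι : Type*} [Fintype ι] [DecidableEq ι]
    {K : Matrix ι ι ℂ} (hK : K.IsHermitian) {l r : ι → ℝ} (hl : ∀ i, 0 ≤ l i) (hr : ∀ i, 0 ≤ r i)
    (h : ∀ z w : ι → ℂ, (star z ⬝ᵥ K *ᵥ w).re ≤
      (∑ i, l i ^ 2 * ‖z i‖ ^ 2 + ∑ i, r i ^ 2 * ‖w i‖ ^ 2) / 2) (x : ι → ℂ) :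
    (star x ⬝ᵥ K *ᵥ x).re ≤ ∑ i, l i * r i * ‖x i‖ ^ 2 := by
  -- The weights l + ε and r + ε are positive and only enlarge the right side of the hypothesis;
  -- then ε → 0+.
  have hcont : Continuous fun ε : ℝ => ∑ i, (l i + ε) * (r i + ε) * ‖x i‖ ^ 2 := by fun_prop
  have hlim := (hcont.tendsto 0).mono_left (nhdsWithin_le_nhds (s := Set.Ioi 0))
  simp only [add_zero] at hlim
  refine ge_of_tendsto hlim (Filter.eventually_of_mem self_mem_nhdsWithin fun ε hε => ?_)
  have hε' : (0 : ℝ) < ε := hε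
  refine hK.re_form_le_of_pos (fun i => by have := hl i; linarith)
    (fun i => by have := hr i; linarith) (fun z w => (h z w).trans ?_) x
  gcongr with i _ i _
  · exact hl i
  · linarith
  · exact hr i
  · linarith

end

/-! ### Trace Cauchy–Schwarz inequality for Hermitian families -/

section

open Matrix
open scoped ComplexOrder Kronecker

theorem Matrix.re_trace_conjTranspose_mul_le {m n : Type*} [Fintype m] [Fintype n]
    (X Y : Matrix m n ℂ) :
    (Xᴴ * Y).trace.re ≤ ((Xᴴ * X).trace.re + (Yᴴ * Y).trace.re) / 2 := by
  have h0 : 0 ≤ ((X - Y)ᴴ * (X - Y)).trace.re :=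
    (Complex.le_def.1 (posSemidef_conjTranspose_mul_self (X - Y)).trace_nonneg).1
  have hs : (Yᴴ * X).trace.re = (Xᴴ * Y).trace.re := by
    have := trace_conjTranspose (Xᴴ * Y)
    rw [conjTranspose_mul, conjTranspose_conjTranspose] at this
    rw [this]; exact Complex.conj_re _
  rw [conjTranspose_sub, Matrix.sub_mul, Matrix.mul_sub, Matrix.mul_sub] at h0
  simp only [trace_sub, Complex.sub_re] at h0
  linarith

theorem Matrix.re_trace_conjTranspose_mul_diagonal_mul {n : Type*} [Fintype n] [DecidableEq n]
    (X : Matrix n n ℂ) (d e : n → ℝ) :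
    (Xᴴ * diagonal (fun i => (d i : ℂ)) * X * diagonal (fun i => (e i : ℂ))).trace.re
      = ∑ j, ∑ k, d j * e k * ‖X j k‖ ^ 2 := by
  rw [Finset.sum_comm]
  simp only [trace, diag, Matrix.mul_apply, diagonal_apply, mul_ite, mul_zero,
    Finset.sum_ite_eq', Finset.mem_univ, if_true, conjTranspose_apply, Complex.re_sum]
  refine Finset.sum_congr rfl fun k _ => ?_
  rw [Finset.sum_mul, Complex.re_sum]
  refine Finset.sum_congr rfl fun j _ => ?_
  rw [← Complex.ofReal_re (d j * e k * ‖X j k‖ ^ 2)]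
  congr 1
  push_cast
  rw [← Complex.conj_mul']
  simp only [RCLike.star_def]
  ring

/-- The inequality `Matrix.re_trace_sum_mul_le` in bases where `∑ a i ^ 2` and `∑ b i ^ 2` are
diagonal, tested on an arbitrary matrix `X`. -/
theorem Matrix.re_trace_sum_mul_le_of_diagonal {κ n : Type*} [Fintype κ] [Fintype n] [DecidableEq n]
    {a b : κ → Matrix n n ℂ}
    (ha : ∀ i, (a i).IsHermitian) (hb : ∀ i, (b i).IsHermitian) {s t : n → ℝ}
    (hs : ∀ i, 0 ≤ s i) (ht : ∀ i, 0 ≤ t i)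
    (hS : ∑ i, a i * a i = diagonal fun j => ((s j ^ 2 : ℝ) : ℂ))
    (hT : ∑ i, b i * b i = diagonal fun j => ((t j ^ 2 : ℝ) : ℂ)) (X : Matrix n n ℂ) :
    (∑ i, Xᴴ * (a i * X * b i)).trace.re ≤ ∑ j, ∑ k, s j * t k * ‖X j k‖ ^ 2 := by
  -- On vectorised matrices K acts as X ↦ ∑ aᵢ X bᵢ. The index of `vec` is (column, row), so S
  -- weights the second component and T the first.
  set K : Matrix (n × n) (n × n) ℂ := ∑ i, (b i)ᵀ ⊗ₖ a i with hKdef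
  have hK : K.IsHermitian := by
    rw [IsHermitian, hKdef, conjTranspose_sum]
    refine Finset.sum_congr rfl fun i _ => ?_
    rw [conjTranspose_kronecker, (hb i).transpose.eq, (ha i).eq]
  have hform : ∀ Z W : Matrix n n ℂ,
      star (vec Z) ⬝ᵥ K *ᵥ vec W = (∑ i, Zᴴ * (a i * W * b i)).trace := by
    intro Z W
    rw [hKdef, sum_mulVec, dotProduct_sum, trace_sum]
    refine Finset.sum_congr rfl fun i _ => ?_
    rw [kronecker_mulVec_vec, star_vec_dotProduct_vec, transpose_transpose]
  have key := hK.re_form_le (l := fun i => s i.2) (r := fun i => t i.1) (fun i => hs i.2)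
    (fun i => ht i.1) (fun z w => ?_) (vec X)
  · rw [hform, Fintype.sum_prod_type, Finset.sum_comm] at key
    exact key
  obtain ⟨Z, rfl⟩ := vec_bijective.surjective z
  obtain ⟨W, rfl⟩ := vec_bijective.surjective w
  rw [hform, trace_sum, Complex.re_sum]
  have hZ : ∑ i : n × n, s i.2 ^ 2 * ‖vec Z i‖ ^ 2
      = ∑ i, ((a i * Z)ᴴ * (a i * Z)).trace.re := by
    have h1 := re_trace_conjTranspose_mul_diagonal_mul Z (fun j => s j ^ 2) (fun _ => 1)
    rw [← hS] at h1
    simp only [Complex.ofReal_one, diagonal_one, Matrix.mul_one] at h1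
    rw [Fintype.sum_prod_type, Finset.sum_comm, ← Complex.re_sum, ← trace_sum]
    simp only [vec]
    rw [Matrix.mul_sum, Finset.sum_mul] at h1
    simp only [conjTranspose_mul, (ha _).eq]
    simp only [Matrix.mul_assoc] at h1 ⊢
    rw [h1]; simp
  have hW : ∑ i : n × n, t i.1 ^ 2 * ‖vec W i‖ ^ 2
      = ∑ i, ((W * b i)ᴴ * (W * b i)).trace.re := by
    have h1 := re_trace_conjTranspose_mul_diagonal_mul W (fun _ => 1) (fun j => t j ^ 2)
    rw [← hT] at h1
    simp only [Complex.ofReal_one, diagonal_one, Matrix.mul_one] at h1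
    rw [Fintype.sum_prod_type, Finset.sum_comm]
    simp only [vec]
    rw [Matrix.mul_sum, trace_sum, Complex.re_sum] at h1
    simp only [one_mul] at h1
    rw [← h1]
    refine Finset.sum_congr rfl fun i _ => ?_
    rw [conjTranspose_mul, (hb i).eq, Matrix.mul_assoc (b i), trace_mul_comm (b i)]
    simp only [Matrix.mul_assoc]
  rw [hZ, hW, ← Finset.sum_add_distrib, Finset.sum_div]
  refine Finset.sum_le_sum fun i _ => ?_
  have h2 := re_trace_conjTranspose_mul_le (a i * Z) (W * b i)
  have h3 : (a i * Z)ᴴ * (W * b i) = Zᴴ * (a i * W * b i) := by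
    rw [conjTranspose_mul, (ha i).eq]; simp only [Matrix.mul_assoc]
  rwa [h3] at h2

theorem Matrix.IsHermitian.eq_mul_diagonal_mul {n : Type*} [Fintype n] [DecidableEq n]
    {M : Matrix n n ℂ} (hM : M.IsHermitian) :
    M = (hM.eigenvectorUnitary : Matrix n n ℂ) * diagonal (fun i => (hM.eigenvalues i : ℂ)) *
      (hM.eigenvectorUnitary : Matrix n n ℂ)ᴴ :=
  hM.spectral_theorem

theorem Matrix.conjTranspose_mul_self_of_unitary {n : Type*} [Fintype n] [DecidableEq n]
    (U : unitaryGroup n ℂ) : (U : Matrix n n ℂ)ᴴ * (U : Matrix n n ℂ) = 1 :=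
  Unitary.coe_star_mul_self U

theorem Matrix.mul_conjTranspose_self_of_unitary {n : Type*} [Fintype n] [DecidableEq n]
    (U : unitaryGroup n ℂ) : (U : Matrix n n ℂ) * (U : Matrix n n ℂ)ᴴ = 1 :=
  Unitary.coe_mul_star_self U

theorem Matrix.sum_conj_mul_self_eq_diagonal {κ n : Type*} [Fintype κ] [Fintype n] [DecidableEq n]
    {a : κ → Matrix n n ℂ} {S : Matrix n n ℂ} (hS : S.IsHermitian)
    (hSa : S * S = ∑ i, a i * a i) :
    ∑ i, ((hS.eigenvectorUnitary : Matrix n n ℂ)ᴴ * a i * (hS.eigenvectorUnitary : Matrix n n ℂ)) *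
      ((hS.eigenvectorUnitary : Matrix n n ℂ)ᴴ * a i * (hS.eigenvectorUnitary : Matrix n n ℂ))
      = diagonal fun j => ((hS.eigenvalues j ^ 2 : ℝ) : ℂ) := by
  set U := (hS.eigenvectorUnitary : Matrix n n ℂ)
  have hU : Uᴴ * U = 1 := conjTranspose_mul_self_of_unitary _
  have hU' : U * Uᴴ = 1 := mul_conjTranspose_self_of_unitary _
  have h1 : ∀ i, (Uᴴ * a i * U) * (Uᴴ * a i * U) = Uᴴ * (a i * a i) * U := fun i => by
    calc (Uᴴ * a i * U) * (Uᴴ * a i * U) = Uᴴ * a i * (U * Uᴴ) * a i * U := by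
          simp only [Matrix.mul_assoc]
      _ = _ := by rw [hU']; simp only [Matrix.mul_assoc, Matrix.one_mul]
  simp only [h1]
  rw [← Finset.sum_mul, ← Matrix.mul_sum, ← hSa]
  have h2 := hS.eq_mul_diagonal_mul
  change S = U * _ * Uᴴ at h2
  set d := diagonal (fun i => (hS.eigenvalues i : ℂ)) with hd
  calc Uᴴ * (S * S) * U = (Uᴴ * U) * d * (Uᴴ * U) * d * (Uᴴ * U) := by
        rw [h2]; simp only [Matrix.mul_assoc]
    _ = _ := by
        rw [hU, hd]
        simp only [Matrix.one_mul, Matrix.mul_one, diagonal_mul_diagonal]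
        congr 1; ext i; push_cast; ring

/-- A trace Cauchy–Schwarz inequality for families of Hermitian matrices and their quadratic
means. -/
theorem Matrix.re_trace_sum_mul_le {κ n : Type*} [Fintype κ] [Fintype n] [DecidableEq n]
    {a b : κ → Matrix n n ℂ} (ha : ∀ i, (a i).IsHermitian) (hb : ∀ i, (b i).IsHermitian)
    {S T : Matrix n n ℂ} (hS : S.PosSemidef) (hT : T.PosSemidef)
    (hSa : S * S = ∑ i, a i * a i) (hTb : T * T = ∑ i, b i * b i) :
    (∑ i, a i * b i).trace.re ≤ (S * T).trace.re := by
  set U := (hS.1.eigenvectorUnitary : Matrix n n ℂ) with hUdef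
  set V := (hT.1.eigenvectorUnitary : Matrix n n ℂ) with hVdef
  have hU' : U * Uᴴ = 1 := mul_conjTranspose_self_of_unitary _
  have hV' : V * Vᴴ = 1 := mul_conjTranspose_self_of_unitary _
  -- The test matrix Uᴴ V is the identity written in the two eigenbases.
  have key := re_trace_sum_mul_le_of_diagonal (a := fun i => Uᴴ * a i * U)
    (b := fun i => Vᴴ * b i * V) (fun i => isHermitian_conjTranspose_mul_mul U (ha i))
    (fun i => isHermitian_conjTranspose_mul_mul V (hb i)) hS.eigenvalues_nonneg
    hT.eigenvalues_nonneg (sum_conj_mul_self_eq_diagonal hS.1 hSa)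
    (sum_conj_mul_self_eq_diagonal hT.1 hTb) (Uᴴ * V)
  rw [← re_trace_conjTranspose_mul_diagonal_mul] at key
  have e1 : ∀ i, ((Uᴴ * V)ᴴ * (Uᴴ * a i * U * (Uᴴ * V) * (Vᴴ * b i * V))).trace
      = (a i * b i).trace := by
    intro i
    have : (Uᴴ * V)ᴴ * (Uᴴ * a i * U * (Uᴴ * V) * (Vᴴ * b i * V))
        = Vᴴ * ((U * Uᴴ) * a i * (U * Uᴴ) * (V * Vᴴ) * b i * V) := by
      rw [conjTranspose_mul, conjTranspose_conjTranspose]; simp only [Matrix.mul_assoc]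
    rw [this, trace_mul_comm, hU', hV', Matrix.one_mul, Matrix.mul_one, Matrix.mul_one,
      Matrix.mul_assoc, Matrix.mul_assoc, hV', Matrix.mul_one]
  have e2 : ((Uᴴ * V)ᴴ * diagonal (fun i => (hS.1.eigenvalues i : ℂ)) * (Uᴴ * V) *
      diagonal (fun i => (hT.1.eigenvalues i : ℂ))).trace = (S * T).trace := by
    have hSe : S = U * diagonal (fun i => (hS.1.eigenvalues i : ℂ)) * Uᴴ :=
      hS.1.eq_mul_diagonal_mul
    have hTe : T = V * diagonal (fun i => (hT.1.eigenvalues i : ℂ)) * Vᴴ :=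
      hT.1.eq_mul_diagonal_mul
    generalize diagonal (fun i => (hS.1.eigenvalues i : ℂ)) = d at hSe ⊢
    generalize diagonal (fun i => (hT.1.eigenvalues i : ℂ)) = e at hTe ⊢
    have hc : ∀ X Y : Matrix n n ℂ, (X * (Y * Vᴴ)).trace = (Vᴴ * (X * Y)).trace := fun X Y => by
      rw [← Matrix.mul_assoc, trace_mul_comm]
    rw [hSe, hTe, hc, conjTranspose_mul, conjTranspose_conjTranspose]
    simp only [Matrix.mul_assoc]
  rw [e2] at key
  simpa only [trace_sum, e1] using key

end

/-! ### Trace powers, eigenbasis overlaps and Hölder's inequality -/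

section

open Matrix
open scoped ComplexOrder

namespace Matrix

variable {n : Type*} [Fintype n] [DecidableEq n]

/-- The trace of the `r`-th power of a Hermitian matrix, through the functional calculus. -/
noncomputable def tracePow (M : Matrix n n ℂ) (r : ℝ) : ℝ :=
  (cfc (fun x : ℝ => x ^ r) M).trace.re

theorem IsHermitian.cfc_eq_mul_diagonal_mul {M : Matrix n n ℂ} (hM : M.IsHermitian) (f : ℝ → ℝ) :
    cfc f M = (hM.eigenvectorUnitary : Matrix n n ℂ) *
      diagonal (fun i => (f (hM.eigenvalues i) : ℂ)) * (hM.eigenvectorUnitary : Matrix n n ℂ)ᴴ :=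
  hM.cfc_eq f

theorem IsHermitian.re_trace_cfc {M : Matrix n n ℂ} (hM : M.IsHermitian) (f : ℝ → ℝ) :
    (cfc f M).trace.re = ∑ i, f (hM.eigenvalues i) := by
  rw [hM.cfc_eq_mul_diagonal_mul, trace_mul_comm, ← Matrix.mul_assoc,
    conjTranspose_mul_self_of_unitary, Matrix.one_mul, trace_diagonal, Complex.re_sum]
  simp

theorem IsHermitian.tracePow_eq {M : Matrix n n ℂ} (hM : M.IsHermitian) (r : ℝ) :
    M.tracePow r = ∑ i, hM.eigenvalues i ^ r :=
  hM.re_trace_cfc _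

theorem PosSemidef.tracePow_nonneg {M : Matrix n n ℂ} (hM : M.PosSemidef) (r : ℝ) :
    0 ≤ M.tracePow r := by
  rw [hM.1.tracePow_eq]
  exact Finset.sum_nonneg fun i _ => Real.rpow_nonneg (hM.eigenvalues_nonneg i) r

/-- The squared moduli of the entries of the change of basis between the eigenbases of two
Hermitian matrices. -/
noncomputable def overlap {M N : Matrix n n ℂ} (hM : M.IsHermitian) (hN : N.IsHermitian)
    (i j : n) : ℝ :=
  ‖((hM.eigenvectorUnitary : Matrix n n ℂ)ᴴ * (hN.eigenvectorUnitary : Matrix n n ℂ)) i j‖ ^ 2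

theorem overlap_nonneg {M N : Matrix n n ℂ} (hM : M.IsHermitian) (hN : N.IsHermitian) (i j : n) :
    0 ≤ overlap hM hN i j := sq_nonneg _

theorem overlap_comm {M N : Matrix n n ℂ} (hM : M.IsHermitian) (hN : N.IsHermitian) (i j : n) :
    overlap hM hN i j = overlap hN hM j i := by
  rw [overlap, overlap]
  rw [show (hN.eigenvectorUnitary : Matrix n n ℂ)ᴴ * (hM.eigenvectorUnitary : Matrix n n ℂ)
    = ((hM.eigenvectorUnitary : Matrix n n ℂ)ᴴ * (hN.eigenvectorUnitary : Matrix n n ℂ))ᴴ by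
      rw [conjTranspose_mul, conjTranspose_conjTranspose], conjTranspose_apply, norm_star]

/-- The change of basis is unitary, so with `sum_overlap_right` the overlaps form a doubly
stochastic matrix. They serve as probability weights that turn trace inequalities into scalar ones.
-/
theorem sum_overlap_left {M N : Matrix n n ℂ} (hM : M.IsHermitian) (hN : N.IsHermitian) (j : n) :
    ∑ i, overlap hM hN i j = 1 := by
  set U := (hM.eigenvectorUnitary : Matrix n n ℂ) with hU
  set V := (hN.eigenvectorUnitary : Matrix n n ℂ) with hV
  have h : (Uᴴ * V)ᴴ * (Uᴴ * V) = 1 := by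
    rw [conjTranspose_mul, conjTranspose_conjTranspose, Matrix.mul_assoc, ← Matrix.mul_assoc U,
      hU, mul_conjTranspose_self_of_unitary, Matrix.one_mul, hV, conjTranspose_mul_self_of_unitary]
  have h1 := congrFun (congrFun h j) j
  rw [Matrix.mul_apply, one_apply_eq] at h1
  have h2 : ((∑ i, overlap hM hN i j : ℝ) : ℂ) = 1 := by
    rw [← h1]
    push_cast
    refine Finset.sum_congr rfl fun i _ => ?_
    rw [overlap, conjTranspose_apply, RCLike.star_def, Complex.conj_mul']
    push_cast; rfl
  exact_mod_cast h2

theorem sum_overlap_right {M N : Matrix n n ℂ} (hM : M.IsHermitian) (hN : N.IsHermitian) (i : n) :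
    ∑ j, overlap hM hN i j = 1 := by
  simp only [overlap_comm hM hN]
  exact sum_overlap_left hN hM i

theorem re_trace_mul_eq_sum_overlap {M N : Matrix n n ℂ} (hM : M.IsHermitian)
    (hN : N.IsHermitian) :
    (M * N).trace.re = ∑ i, ∑ j, hM.eigenvalues i * hN.eigenvalues j * overlap hM hN i j := by
  have h := re_trace_conjTranspose_mul_diagonal_mul
    ((hM.eigenvectorUnitary : Matrix n n ℂ)ᴴ * (hN.eigenvectorUnitary : Matrix n n ℂ))
    hM.eigenvalues hN.eigenvalues
  unfold overlap
  rw [← h]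
  have hMe := hM.eq_mul_diagonal_mul
  have hNe := hN.eq_mul_diagonal_mul
  set U := (hM.eigenvectorUnitary : Matrix n n ℂ)
  set V := (hN.eigenvectorUnitary : Matrix n n ℂ)
  generalize diagonal (fun i => (hM.eigenvalues i : ℂ)) = d at hMe ⊢
  generalize diagonal (fun i => (hN.eigenvalues i : ℂ)) = e at hNe ⊢
  have hc : ∀ X Y : Matrix n n ℂ, (X * (Y * Vᴴ)).trace = (Vᴴ * (X * Y)).trace := fun X Y => by
    rw [← Matrix.mul_assoc, trace_mul_comm]
  rw [hMe, hNe, hc, conjTranspose_mul, conjTranspose_conjTranspose]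
  simp only [Matrix.mul_assoc]

theorem overlap_form_eq {M N : Matrix n n ℂ} (hM : M.IsHermitian) (hN : N.IsHermitian) (i : n) :
    (((hM.eigenvectorUnitary : Matrix n n ℂ)ᴴ * N * (hM.eigenvectorUnitary : Matrix n n ℂ)) i i).re
      = ∑ j, hN.eigenvalues j * overlap hM hN i j := by
  have hNe := hN.eq_mul_diagonal_mul
  unfold overlap
  set U := (hM.eigenvectorUnitary : Matrix n n ℂ)
  set V := (hN.eigenvectorUnitary : Matrix n n ℂ)
  have h1 : Uᴴ * N * U = (Uᴴ * V) * diagonal (fun i => (hN.eigenvalues i : ℂ)) * (Uᴴ * V)ᴴ := by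
    conv_lhs => rw [hNe]
    rw [conjTranspose_mul, conjTranspose_conjTranspose]
    simp only [Matrix.mul_assoc]
  rw [h1, Matrix.mul_apply, Complex.re_sum]
  refine Finset.sum_congr rfl fun j _ => ?_
  rw [mul_diagonal, conjTranspose_apply, RCLike.star_def, mul_right_comm, Complex.mul_conj',
    ← Complex.ofReal_pow, ← Complex.ofReal_mul, Complex.ofReal_re, mul_comm]

theorem IsHermitian.conjTranspose_mul_mul_eq_diagonal {M : Matrix n n ℂ} (hM : M.IsHermitian) :
    (hM.eigenvectorUnitary : Matrix n n ℂ)ᴴ * M * (hM.eigenvectorUnitary : Matrix n n ℂ)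
      = diagonal fun i => (hM.eigenvalues i : ℂ) := by
  have hMe := hM.eq_mul_diagonal_mul
  set U := (hM.eigenvectorUnitary : Matrix n n ℂ)
  have hU' : Uᴴ * U = 1 := conjTranspose_mul_self_of_unitary _
  calc Uᴴ * M * U = Uᴴ * (U * (diagonal fun i => (hM.eigenvalues i : ℂ)) * Uᴴ) * U := by
        rw [← hMe]
    _ = (Uᴴ * U) * (diagonal fun i => (hM.eigenvalues i : ℂ)) * (Uᴴ * U) := by
        simp only [Matrix.mul_assoc]
    _ = _ := by rw [hU', Matrix.one_mul, Matrix.mul_one]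

/-- Compare diagonal entries in the eigenbasis of M: there X and Y contribute averages of their own
eigenvalues. This replaces simultaneous diagonalisation in the bounds for tr(X + Y)^r. -/
theorem eigenvalues_add_eq {M X Y : Matrix n n ℂ} (hM : M.IsHermitian) (hX : X.IsHermitian)
    (hY : Y.IsHermitian) (h : M = X + Y) (i : n) :
    hM.eigenvalues i = ∑ j, hX.eigenvalues j * overlap hM hX i j +
      ∑ j, hY.eigenvalues j * overlap hM hY i j := by
  rw [← overlap_form_eq hM hX, ← overlap_form_eq hM hY, ← Complex.add_re, ← Matrix.add_apply,
    ← Matrix.add_mul, ← Matrix.mul_add, ← h, hM.conjTranspose_mul_mul_eq_diagonal,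
    diagonal_apply_eq, Complex.ofReal_re]

/-- Hölder's inequality for the trace of a product of positive semidefinite matrices. -/
theorem PosSemidef.re_trace_mul_le_tracePow {M N : Matrix n n ℂ} (hM : M.PosSemidef)
    (hN : N.PosSemidef) {p q : ℝ} (hpq : p.HolderConjugate q) :
    (M * N).trace.re ≤ M.tracePow p ^ (1 / p) * N.tracePow q ^ (1 / q) := by
  rw [re_trace_mul_eq_sum_overlap hM.1 hN.1, hM.1.tracePow_eq, hN.1.tracePow_eq]
  set w := overlap hM.1 hN.1
  have hw : ∀ i j, 0 ≤ w i j := overlap_nonneg _ _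
  have hp0 := hpq.pos
  have hq0 := hpq.symm.pos
  -- Scalar Hölder on pairs of indices, with the weight split as w = w^(1/p) w^(1/q). Double
  -- stochasticity then sums out the index that does not occur.
  have H := Real.inner_le_Lp_mul_Lq_of_nonneg (Finset.univ : Finset (n × n))
    (f := fun ij => hM.1.eigenvalues ij.1 * w ij.1 ij.2 ^ (1 / p))
    (g := fun ij => hN.1.eigenvalues ij.2 * w ij.1 ij.2 ^ (1 / q)) hpq
    (fun ij _ => mul_nonneg (hM.eigenvalues_nonneg _) (Real.rpow_nonneg (hw _ _) _))
    (fun ij _ => mul_nonneg (hN.eigenvalues_nonneg _) (Real.rpow_nonneg (hw _ _) _))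
  have e0 : ∀ i j, hM.1.eigenvalues i * w i j ^ (1 / p) * (hN.1.eigenvalues j * w i j ^ (1 / q))
      = hM.1.eigenvalues i * hN.1.eigenvalues j * w i j := by
    intro i j
    rw [mul_mul_mul_comm, ← Real.rpow_add' (hw i j), one_div, one_div, hpq.inv_add_inv_eq_one,
      Real.rpow_one]
    rw [one_div, one_div, hpq.inv_add_inv_eq_one]; exact one_ne_zero
  have e1 : ∀ i j, (hM.1.eigenvalues i * w i j ^ (1 / p)) ^ p = hM.1.eigenvalues i ^ p * w i j := by
    intro i j
    rw [Real.mul_rpow (hM.eigenvalues_nonneg _) (Real.rpow_nonneg (hw _ _) _),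
      ← Real.rpow_mul (hw _ _),
      one_div_mul_cancel hp0.ne', Real.rpow_one]
  have e2 : ∀ i j, (hN.1.eigenvalues j * w i j ^ (1 / q)) ^ q = hN.1.eigenvalues j ^ q * w i j := by
    intro i j
    rw [Real.mul_rpow (hN.eigenvalues_nonneg _) (Real.rpow_nonneg (hw _ _) _),
      ← Real.rpow_mul (hw _ _),
      one_div_mul_cancel hq0.ne', Real.rpow_one]
  simp only [Fintype.sum_prod_type, e0, e1, e2] at H
  rw [Finset.sum_comm (f := fun i j => hN.1.eigenvalues j ^ q * w i j)] at H
  simpa only [← Finset.mul_sum, sum_overlap_right, sum_overlap_left, w, mul_one] using H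

end Matrix

end

/-! ### Convexity and subadditivity of trace powers -/

section

open Matrix
open scoped ComplexOrder

namespace Matrix

variable {n : Type*} [Fintype n] [DecidableEq n]

/-- Convexity of `tr M ^ r` for `1 ≤ r`. -/
theorem PosSemidef.tracePow_add_le_of_one_le {X Y : Matrix n n ℂ} (hX : X.PosSemidef)
    (hY : Y.PosSemidef) {r : ℝ} (hr : 1 ≤ r) :
    (X + Y).tracePow r ≤ 2 ^ (r - 1) * (X.tracePow r + Y.tracePow r) := by
  have hM : (X + Y).PosSemidef := hX.add hY
  rw [hM.1.tracePow_eq, hX.1.tracePow_eq, hY.1.tracePow_eq]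
  -- Jensen's inequality for x^r, row by row in the overlap weights.
  have hj : ∀ {Z : Matrix n n ℂ} (hZ : Z.PosSemidef) (i : n),
      (∑ j, hZ.1.eigenvalues j * overlap hM.1 hZ.1 i j) ^ r
        ≤ ∑ j, hZ.1.eigenvalues j ^ r * overlap hM.1 hZ.1 i j := by
    intro Z hZ i
    have hw0 := overlap_nonneg hM.1 hZ.1 i
    have hw1 := sum_overlap_right hM.1 hZ.1 i
    have hz0 := hZ.eigenvalues_nonneg
    generalize hZ.1.eigenvalues = z at *
    generalize overlap hM.1 hZ.1 i = w at *
    simp only [mul_comm _ (w _)]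
    exact Real.rpow_arith_mean_le_arith_mean_rpow Finset.univ w z (fun j _ => hw0 j) hw1
      (fun j _ => hz0 j) hr
  have hs : ∀ {Z : Matrix n n ℂ} (hZ : Z.PosSemidef),
      ∑ i, ∑ j, hZ.1.eigenvalues j ^ r * overlap hM.1 hZ.1 i j = ∑ j, hZ.1.eigenvalues j ^ r := by
    intro Z hZ
    rw [Finset.sum_comm]
    simp only [← Finset.mul_sum, sum_overlap_left, mul_one]
  rw [← hs hX, ← hs hY, ← Finset.sum_add_distrib, Finset.mul_sum]
  refine Finset.sum_le_sum fun i _ => ?_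
  rw [eigenvalues_add_eq hM.1 hX.1 hY.1 rfl]
  have h0 : ∀ {Z : Matrix n n ℂ} (hZ : Z.PosSemidef),
      0 ≤ ∑ j, hZ.1.eigenvalues j * overlap hM.1 hZ.1 i j := fun hZ =>
    Finset.sum_nonneg fun j _ => mul_nonneg (hZ.eigenvalues_nonneg j) (overlap_nonneg _ _ _ _)
  have hc := NNReal.rpow_add_le_mul_rpow_add_rpow ⟨_, h0 hX⟩ ⟨_, h0 hY⟩ hr
  rw [← NNReal.coe_le_coe] at hc
  push_cast at hc
  refine hc.trans ?_
  gcongr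
  · exact hj hX i
  · exact hj hY i

/-- Antitonicity of the inverse in a form that allows zeros of m. With D = diag(m⁻¹), where 0⁻¹ = 0
still gives D diag(m) D = D, congruence by D W yields T - T diag(x) Tᴴ ≥ 0 for T = Wᴴ D W. On the
diagonal, keep only the term j = i of the second product. -/
theorem mul_sq_sum_inv_le_of_posSemidef {m x : n → ℝ} (hx : ∀ i, 0 ≤ x i) {W : Matrix n n ℂ}
    (h : (diagonal (fun i => (m i : ℂ)) - W * diagonal (fun i => (x i : ℂ)) * Wᴴ).PosSemidef)
    (i : n) :
    x i * (∑ a, ‖W a i‖ ^ 2 * (m a)⁻¹) ^ 2 ≤ ∑ a, ‖W a i‖ ^ 2 * (m a)⁻¹ := by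
  set D : Matrix n n ℂ := diagonal fun a => ((m a)⁻¹ : ℂ) with hD
  have hDH : Dᴴ = D := by
    rw [hD, diagonal_conjTranspose]
    congr 1; ext i; simp
  have hpsd := h.conjTranspose_mul_mul_same (D * W)
  set T := Wᴴ * D * W with hT
  have e1 : (D * W)ᴴ * (diagonal (fun i => (m i : ℂ)) - W * diagonal (fun i => (x i : ℂ)) * Wᴴ)
      * (D * W) = Wᴴ * (D * (diagonal fun i => (m i : ℂ)) * D) * W
        - T * (diagonal fun i => (x i : ℂ)) * Tᴴ := by
    rw [Matrix.mul_sub, Matrix.sub_mul]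
    simp only [hT, conjTranspose_mul, hDH, conjTranspose_conjTranspose, Matrix.mul_assoc]
  have hentry : ∀ d : n → ℝ, (Wᴴ * diagonal (fun i => (d i : ℂ)) * W) i i
      = ((∑ a, ‖W a i‖ ^ 2 * d a : ℝ) : ℂ) := by
    intro d
    rw [Matrix.mul_apply]
    push_cast
    refine Finset.sum_congr rfl fun a _ => ?_
    rw [mul_diagonal, conjTranspose_apply, RCLike.star_def, mul_right_comm, Complex.conj_mul']
  have e2 : D * (diagonal fun i => (m i : ℂ)) * D = diagonal fun i => (((m i)⁻¹ : ℝ) : ℂ) := by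
    rw [hD, diagonal_mul_diagonal, diagonal_mul_diagonal]
    congr 1; ext a
    push_cast
    by_cases ha : (m a : ℂ) = 0
    · simp [ha]
    · field_simp
  have e3 : T i i = ((∑ a, ‖W a i‖ ^ 2 * (m a)⁻¹ : ℝ) : ℂ) := by
    rw [hT, ← hentry, hD]
    simp only [Complex.ofReal_inv]
  set t := ∑ a, ‖W a i‖ ^ 2 * (m a)⁻¹
  have e4 : x i * t ^ 2 ≤ ((T * (diagonal fun i => (x i : ℂ)) * Tᴴ) i i).re := by
    rw [Matrix.mul_apply, Complex.re_sum]
    have e5 : ∀ j, ((T * (diagonal fun i => (x i : ℂ))) i j * Tᴴ j i).re = x j * ‖T i j‖ ^ 2 := by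
      intro j
      rw [mul_diagonal, conjTranspose_apply, RCLike.star_def, mul_right_comm, Complex.mul_conj',
        ← Complex.ofReal_pow, ← Complex.ofReal_mul, Complex.ofReal_re, mul_comm]
    simp only [e5]
    have := Finset.single_le_sum (f := fun j => x j * ‖T i j‖ ^ 2)
      (fun j _ => mul_nonneg (hx j) (sq_nonneg _)) (Finset.mem_univ i)
    refine le_trans (le_of_eq ?_) this
    rw [e3, Complex.norm_real, Real.norm_eq_abs, sq_abs]
  have h0 := (Complex.le_def.1 (hpsd.diag_nonneg (i := i))).1
  rw [e1, e2, Matrix.sub_apply, Complex.sub_re, hentry, Complex.ofReal_re, Complex.zero_re] at h0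
  linarith

theorem PosSemidef.eigenvalues_mul_sq_le {M X : Matrix n n ℂ} (hM : M.PosSemidef)
    (hX : X.PosSemidef) (h : (M - X).PosSemidef) (i : n) :
    hX.1.eigenvalues i * (∑ a, overlap hM.1 hX.1 a i * (hM.1.eigenvalues a)⁻¹) ^ 2
      ≤ ∑ a, overlap hM.1 hX.1 a i * (hM.1.eigenvalues a)⁻¹ := by
  have hMd := hM.1.conjTranspose_mul_mul_eq_diagonal
  have hXe := hX.1.eq_mul_diagonal_mul
  refine mul_sq_sum_inv_le_of_posSemidef hX.eigenvalues_nonneg ?_ i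
  have hpsd := h.conjTranspose_mul_mul_same (hM.1.eigenvectorUnitary : Matrix n n ℂ)
  generalize (hM.1.eigenvectorUnitary : Matrix n n ℂ) = U at *
  generalize (hX.1.eigenvectorUnitary : Matrix n n ℂ) = V at *
  rw [← hMd]
  generalize diagonal (fun i => (hX.1.eigenvalues i : ℂ)) = d at *
  have e : Uᴴ * M * U - Uᴴ * V * d * (Uᴴ * V)ᴴ = Uᴴ * (M - X) * U := by
    rw [Matrix.mul_sub, Matrix.sub_mul, hXe, conjTranspose_mul, conjTranspose_conjTranspose]
    simp only [Matrix.mul_assoc]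
  rwa [e]

/-- Summed over i, this is tr(X M^(r-1)) ≤ tr X^r for X ≤ M. Jensen for the concave power 1 - r
bounds the sum by t^(1-r), where t is the mean of the inverse eigenvalues of M. When x > 0,
`eigenvalues_mul_sq_le` gives x t ≤ 1, hence x t^(1-r) = x^r (x t)^(1-r) ≤ x^r. Zero eigenvalues of
M contribute 0 under both conventions for negative powers. -/
theorem PosSemidef.eigenvalues_mul_sum_rpow_le {M X : Matrix n n ℂ} (hM : M.PosSemidef)
    (hX : X.PosSemidef) (h : (M - X).PosSemidef) {r : ℝ} (hr0 : 0 < r) (hr1 : r < 1) (i : n) :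
    hX.1.eigenvalues i * ∑ a, overlap hM.1 hX.1 a i * hM.1.eigenvalues a ^ (r - 1)
      ≤ hX.1.eigenvalues i ^ r := by
  have key := hM.eigenvalues_mul_sq_le hX h i
  set t := ∑ a, overlap hM.1 hX.1 a i * (hM.1.eigenvalues a)⁻¹ with ht
  have ht0 : 0 ≤ t := Finset.sum_nonneg fun a _ =>
    mul_nonneg (overlap_nonneg _ _ _ _) (inv_nonneg.2 (hM.eigenvalues_nonneg a))
  have hJ : ∑ a, overlap hM.1 hX.1 a i * hM.1.eigenvalues a ^ (r - 1) ≤ t ^ (1 - r) := by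
    have := (Real.concaveOn_rpow (p := 1 - r) (by linarith) (by linarith)).le_map_sum
      (t := Finset.univ) (w := fun a => overlap hM.1 hX.1 a i)
      (p := fun a => (hM.1.eigenvalues a)⁻¹) (fun a _ => overlap_nonneg _ _ _ _)
      (sum_overlap_left _ _ i) (fun a _ => inv_nonneg.2 (hM.eigenvalues_nonneg a))
    simp only [smul_eq_mul] at this
    refine le_trans (le_of_eq (Finset.sum_congr rfl fun a _ => ?_)) this
    rw [Real.inv_rpow (hM.eigenvalues_nonneg a), ← Real.rpow_neg (hM.eigenvalues_nonneg a), neg_sub]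
  rcases (hX.eigenvalues_nonneg i).eq_or_lt with hx | hx
  · rw [← hx, zero_mul]; exact Real.rpow_nonneg le_rfl r
  · refine (mul_le_mul_of_nonneg_left hJ hx.le).trans ?_
    have hxt : hX.1.eigenvalues i * t ≤ 1 := by
      rcases ht0.eq_or_lt with h0 | h0
      · rw [← h0, mul_zero]; exact zero_le_one
      · refine le_of_mul_le_mul_right ?_ h0
        rw [one_mul, mul_assoc, ← sq]; exact key
    have hsplit : hX.1.eigenvalues i = hX.1.eigenvalues i ^ r * hX.1.eigenvalues i ^ (1 - r) := by
      rw [← Real.rpow_add hx]; simp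
    calc hX.1.eigenvalues i * t ^ (1 - r)
        = hX.1.eigenvalues i ^ r * (hX.1.eigenvalues i * t) ^ (1 - r) := by
          rw [Real.mul_rpow hx.le ht0, ← mul_assoc, ← hsplit]
      _ ≤ hX.1.eigenvalues i ^ r * 1 := by
          gcongr
          exact Real.rpow_le_one (mul_nonneg hx.le ht0) hxt (by linarith)
      _ = _ := mul_one _

/-- Subadditivity of `tr M ^ r` for `0 < r < 1` (Rotfel'd's inequality). -/
theorem PosSemidef.tracePow_add_le_of_lt_one {X Y : Matrix n n ℂ} (hX : X.PosSemidef)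
    (hY : Y.PosSemidef) {r : ℝ} (hr0 : 0 < r) (hr1 : r < 1) :
    (X + Y).tracePow r ≤ X.tracePow r + Y.tracePow r := by
  have hM : (X + Y).PosSemidef := hX.add hY
  rw [hM.1.tracePow_eq, hX.1.tracePow_eq, hY.1.tracePow_eq]
  -- This expresses tr M^r = tr(X M^(r-1)) + tr(Y M^(r-1)) for M = X + Y, one eigenvalue of M at a
  -- time; each summand is then bounded using X ≤ M and Y ≤ M.
  have h1 : ∀ a, hM.1.eigenvalues a ^ r =
      ∑ j, hX.1.eigenvalues j * (overlap hM.1 hX.1 a j * hM.1.eigenvalues a ^ (r - 1)) +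
      ∑ j, hY.1.eigenvalues j * (overlap hM.1 hY.1 a j * hM.1.eigenvalues a ^ (r - 1)) := by
    intro a
    simp only [← mul_assoc]
    rw [← Finset.sum_mul, ← Finset.sum_mul, ← add_mul, ← eigenvalues_add_eq hM.1 hX.1 hY.1 rfl]
    rcases (hM.eigenvalues_nonneg a).eq_or_lt with h0 | h0
    · rw [← h0, zero_mul, Real.zero_rpow hr0.ne']
    · rw [Real.rpow_sub_one h0.ne', mul_div_cancel₀ _ h0.ne']
  simp only [h1]
  rw [Finset.sum_add_distrib, Finset.sum_comm, Finset.sum_comm (γ := n)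
    (f := fun a j => hY.1.eigenvalues j * (overlap hM.1 hY.1 a j * hM.1.eigenvalues a ^ (r - 1)))]
  simp only [← Finset.mul_sum]
  refine add_le_add (Finset.sum_le_sum fun i _ => ?_) (Finset.sum_le_sum fun i _ => ?_)
  · exact hM.eigenvalues_mul_sum_rpow_le hX (by simpa using hY) hr0 hr1 i
  · exact hM.eigenvalues_mul_sum_rpow_le hY (by simpa using hX) hr0 hr1 i

theorem tracePow_mul_conjTranspose_self (B : Matrix n n ℂ) (r : ℝ) :
    (B * Bᴴ).tracePow r = (Bᴴ * B).tracePow r := by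
  have h1 : (B * Bᴴ).IsHermitian := isHermitian_mul_conjTranspose_self B
  have h2 : (Bᴴ * B).IsHermitian := isHermitian_conjTranspose_mul_self B
  rw [h1.tracePow_eq, h2.tracePow_eq,
    (h1.eigenvalues_eq_eigenvalues_iff h2).2 (charpoly_mul_comm _ _)]

theorem PosSemidef.tracePow_smul {M : Matrix n n ℂ} (hM : M.PosSemidef) {c : ℝ} (hc : 0 ≤ c)
    (r : ℝ) : (c • M).tracePow r = c ^ r * M.tracePow r := by
  have hM' : IsSelfAdjoint M := hM.1
  have hspec : (spectrum ℝ M).Finite := finite_real_spectrum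
  rw [tracePow, ← cfc_comp_smul c (fun x : ℝ => x ^ r) M ((hspec.image _).continuousOn _),
    hM.1.re_trace_cfc, hM.1.tracePow_eq, Finset.mul_sum]
  refine Finset.sum_congr rfl fun i _ => ?_
  rw [smul_eq_mul, Real.mul_rpow hc (hM.eigenvalues_nonneg i)]

/-- The two summands have equal trace powers, so the constants combine to (1/2)^r · 2^(r-1) · 2 = 1.
In the companion case r < 1, subadditivity leaves (1/2)^r · 2 = 2^(1-r). -/
theorem tracePow_half_add_le_of_one_le (B : Matrix n n ℂ) {r : ℝ} (hr : 1 ≤ r) :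
    ((1 / 2 : ℝ) • (Bᴴ * B + B * Bᴴ)).tracePow r ≤ (Bᴴ * B).tracePow r := by
  have h1 := posSemidef_conjTranspose_mul_self B
  have h2 := posSemidef_self_mul_conjTranspose B
  rw [(h1.add h2).tracePow_smul (by norm_num)]
  refine (mul_le_mul_of_nonneg_left (h1.tracePow_add_le_of_one_le h2 hr)
    (by positivity)).trans (le_of_eq ?_)
  rw [tracePow_mul_conjTranspose_self, Real.div_rpow zero_le_one zero_le_two, Real.one_rpow,
    Real.rpow_sub_one two_ne_zero]
  field_simp
  ring

theorem tracePow_half_add_le_of_lt_one (B : Matrix n n ℂ) {r : ℝ} (hr0 : 0 < r) (hr1 : r < 1) :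
    ((1 / 2 : ℝ) • (Bᴴ * B + B * Bᴴ)).tracePow r ≤ 2 ^ (1 - r) * (Bᴴ * B).tracePow r := by
  have h1 := posSemidef_conjTranspose_mul_self B
  have h2 := posSemidef_self_mul_conjTranspose B
  rw [(h1.add h2).tracePow_smul (by norm_num)]
  refine (mul_le_mul_of_nonneg_left (h1.tracePow_add_le_of_lt_one h2 hr0 hr1)
    (by positivity)).trans (le_of_eq ?_)
  rw [tracePow_mul_conjTranspose_self, Real.div_rpow zero_le_one zero_le_two, Real.one_rpow,
    Real.rpow_sub two_pos, Real.rpow_one]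
  field_simp
  ring

end Matrix

end

/-! ### The quadratic symmetric modulus and the duality argument -/

section

open Matrix
open scoped ComplexOrder

namespace Matrix

variable {n : Type*} [Fintype n] [DecidableEq n]

theorem tracePow_eq_trace_rpow {M : Matrix n n ℂ} (hM : 0 ≤ M) (r : ℝ) :
    M.tracePow r = (M ^ r).trace.re := by
  rw [CFC.rpow_eq_cfc_real hM, tracePow]

theorem tracePow_sqrt {M : Matrix n n ℂ} (hM : 0 ≤ M) {r : ℝ} (hr : 0 ≤ r) :
    (CFC.sqrt M).tracePow r = M.tracePow (r / 2) := by
  rw [tracePow_eq_trace_rpow (CFC.sqrt_nonneg M), tracePow_eq_trace_rpow hM, CFC.sqrt_eq_rpow,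
    CFC.rpow_rpow_of_exponent_nonneg M _ _ (by norm_num) hr hM]
  congr 3; ring

theorem PosSemidef.tracePow_conjTranspose_mul_self {M : Matrix n n ℂ} (hM : M.PosSemidef) {r : ℝ}
    (hr : 0 ≤ r) : (Mᴴ * M).tracePow (r / 2) = M.tracePow r := by
  have h0 : 0 ≤ M := nonneg_iff_posSemidef.2 hM
  rw [← tracePow_sqrt (nonneg_iff_posSemidef.2 (posSemidef_conjTranspose_mul_self M)) hr, hM.1.eq,
    CFC.sqrt_mul_self M h0]

theorem IsHermitian.tracePow_cfc {M : Matrix n n ℂ} (hM : M.IsHermitian) (f : ℝ → ℝ) (r : ℝ) :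
    (cfc f M).tracePow r = ∑ i, f (hM.eigenvalues i) ^ r := by
  have hM' : IsSelfAdjoint M := hM
  have hspec : (spectrum ℝ M).Finite := finite_real_spectrum
  rw [tracePow, ← cfc_comp' (fun x : ℝ => x ^ r) f M ((hspec.image _).continuousOn _)
    (hspec.continuousOn _), hM.re_trace_cfc]

theorem IsHermitian.im_trace_mul {n : Type*} [Fintype n] {X Y : Matrix n n ℂ}
    (hX : X.IsHermitian) (hY : Y.IsHermitian) : (X * Y).trace.im = 0 := by
  have := trace_conjTranspose (X * Y)
  rw [conjTranspose_mul, hX.eq, hY.eq, trace_mul_comm] at this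
  exact Complex.conj_eq_iff_im.1 this.symm

theorem isHermitian_realPart {n : Type*} (Z : Matrix n n ℂ) : (ℜ Z : Matrix n n ℂ).IsHermitian :=
  (ℜ Z).2

theorem isHermitian_imaginaryPart {n : Type*} (Z : Matrix n n ℂ) : (ℑ Z : Matrix n n ℂ).IsHermitian :=
  (ℑ Z).2

theorem realPart_sq_add_imaginaryPart_sq (Z : Matrix n n ℂ) :
    (ℜ Z : Matrix n n ℂ) ^ 2 + (ℑ Z : Matrix n n ℂ) ^ 2 = (1 / 2 : ℝ) • (Zᴴ * Z + Z * Zᴴ) := by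
  rw [realPart_apply_coe, imaginaryPart_apply_coe]
  simp only [star_eq_conjTranspose, sq, Matrix.smul_mul, Matrix.mul_smul,
    Matrix.mul_add, Matrix.add_mul, Matrix.mul_sub, Matrix.sub_mul]
  ext i j
  simp only [Matrix.add_apply, Matrix.smul_apply, Matrix.sub_apply, Complex.real_smul, smul_eq_mul]
  push_cast
  linear_combination
    (((Z * Z) i j - (Zᴴ * Z) i j - ((Z * Zᴴ) i j - (Zᴴ * Zᴴ) i j)) / 4 : ℂ) * Complex.I_sq

/-- The cross terms are ±i times traces of products of two Hermitian matrices. Such traces are real,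
so the cross terms have no real part. -/
theorem re_trace_conjTranspose_mul_eq {n : Type*} [Fintype n] (A B : Matrix n n ℂ) :
    (Aᴴ * B).trace.re = ((ℜ A : Matrix n n ℂ) * (ℜ B : Matrix n n ℂ) +
      (ℑ A : Matrix n n ℂ) * (ℑ B : Matrix n n ℂ)).trace.re := by
  have hA := isHermitian_realPart A
  have hA' := isHermitian_imaginaryPart A
  have hB := isHermitian_realPart B
  have hB' := isHermitian_imaginaryPart B
  conv_lhs => rw [← realPart_add_I_smul_imaginaryPart A, ← realPart_add_I_smul_imaginaryPart B]
  rw [conjTranspose_add, conjTranspose_smul, hA.eq, hA'.eq]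
  simp only [Matrix.mul_add, Matrix.add_mul, Matrix.smul_mul, Matrix.mul_smul, trace_add,
    trace_smul, smul_eq_mul, Complex.add_re, Complex.mul_re, Complex.add_im, Complex.I_re, Complex.I_im,
    hA.im_trace_mul hB', hA'.im_trace_mul hB, RCLike.star_def, Complex.conj_I, Complex.neg_re,
    Complex.neg_im, Complex.mul_im]
  ring

end Matrix

open Matrix

section qsymModulus

variable {n : ℕ}

theorem qsymModulus_eq_sqrt (Z : Matrix (Fin n) (Fin n) ℂ) :
    qsymModulus Z = CFC.sqrt ((1 / 2 : ℝ) • (Zᴴ * Z + Z * Zᴴ)) := by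
  rw [qsymModulus, realPart_sq_add_imaginaryPart_sq]

theorem half_smul_add_posSemidef (Z : Matrix (Fin n) (Fin n) ℂ) :
    ((1 / 2 : ℝ) • (Zᴴ * Z + Z * Zᴴ)).PosSemidef :=
  ((posSemidef_conjTranspose_mul_self Z).add (posSemidef_self_mul_conjTranspose Z)).smul
    (by norm_num)

theorem qsymModulus_posSemidef (Z : Matrix (Fin n) (Fin n) ℂ) : (qsymModulus Z).PosSemidef :=
  nonneg_iff_posSemidef.1 (CFC.sqrt_nonneg _)

theorem qsymModulus_mul_self (Z : Matrix (Fin n) (Fin n) ℂ) :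
    qsymModulus Z * qsymModulus Z = (ℜ Z : Matrix (Fin n) (Fin n) ℂ) * (ℜ Z : Matrix _ _ ℂ) +
      (ℑ Z : Matrix (Fin n) (Fin n) ℂ) * (ℑ Z : Matrix _ _ ℂ) := by
  rw [qsymModulus_eq_sqrt, CFC.sqrt_mul_sqrt_self _
    (nonneg_iff_posSemidef.2 (half_smul_add_posSemidef Z)), ← realPart_sq_add_imaginaryPart_sq, sq,
    sq]

theorem tracePow_qsymModulus (Z : Matrix (Fin n) (Fin n) ℂ) {r : ℝ} (hr : 0 ≤ r) :
    (qsymModulus Z).tracePow r = ((1 / 2 : ℝ) • (Zᴴ * Z + Z * Zᴴ)).tracePow (r / 2) := by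
  rw [qsymModulus_eq_sqrt, tracePow_sqrt (nonneg_iff_posSemidef.2 (half_smul_add_posSemidef Z)) hr]

/-- The pairing of two matrices is dominated by that of their quadratic symmetric moduli. -/
theorem re_trace_conjTranspose_mul_le_qsymModulus (A B : Matrix (Fin n) (Fin n) ℂ) :
    (Aᴴ * B).trace.re ≤ (qsymModulus A * qsymModulus B).trace.re := by
  have h := re_trace_sum_mul_le (κ := Fin 2)
    (a := ![(ℜ A : Matrix (Fin n) (Fin n) ℂ), (ℑ A : Matrix (Fin n) (Fin n) ℂ)])
    (b := ![(ℜ B : Matrix (Fin n) (Fin n) ℂ), (ℑ B : Matrix (Fin n) (Fin n) ℂ)])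
    (Fin.forall_fin_two.2 ⟨isHermitian_realPart A, isHermitian_imaginaryPart A⟩)
    (Fin.forall_fin_two.2 ⟨isHermitian_realPart B, isHermitian_imaginaryPart B⟩)
    (qsymModulus_posSemidef A) (qsymModulus_posSemidef B)
    (by rw [Fin.sum_univ_two]; exact qsymModulus_mul_self A)
    (by rw [Fin.sum_univ_two]; exact qsymModulus_mul_self B)
  rw [Fin.sum_univ_two] at h
  rw [re_trace_conjTranspose_mul_eq]
  exact h

theorem sum_qsymModulus_posSemidef {m : ℕ} (A : Fin m → Matrix (Fin n) (Fin n) ℂ) :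
    (∑ k, qsymModulus (A k)).PosSemidef :=
  posSemidef_sum _ fun k _ => qsymModulus_posSemidef (A k)

theorem re_trace_sum_conjTranspose_mul_le {m : ℕ} (A : Fin m → Matrix (Fin n) (Fin n) ℂ)
    (B : Matrix (Fin n) (Fin n) ℂ) :
    ((∑ k, A k)ᴴ * B).trace.re ≤ ((∑ k, qsymModulus (A k)) * qsymModulus B).trace.re := by
  rw [conjTranspose_sum, Finset.sum_mul, Finset.sum_mul, trace_sum, trace_sum, Complex.re_sum,
    Complex.re_sum]
  exact Finset.sum_le_sum fun k _ => re_trace_conjTranspose_mul_le_qsymModulus (A k) B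

end qsymModulus

/-- The duality step: a bound for `tr (|B|_qsym) ^ q` in terms of `tr |B| ^ q` gives a bound between
the Schatten norms with the conjugate exponent. -/
theorem tracePow_sum_le_of_dual {n m : ℕ} {p q C : ℝ} (hpq : p.HolderConjugate q) (hC : 0 ≤ C)
    (h : ∀ B : Matrix (Fin n) (Fin n) ℂ,
      ((1 / 2 : ℝ) • (Bᴴ * B + B * Bᴴ)).tracePow (q / 2) ≤ C * (Bᴴ * B).tracePow (q / 2))
    (A : Fin m → Matrix (Fin n) (Fin n) ℂ) :
    ((∑ k, A k)ᴴ * ∑ k, A k).tracePow (p / 2) ^ (1 / p) ≤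
      C ^ (1 / q) * (∑ k, qsymModulus (A k)).tracePow p ^ (1 / p) := by
  have hp0 := hpq.pos
  have hq0 := hpq.symm.pos
  set S := ∑ k, A k
  set Q := ∑ k, qsymModulus (A k)
  have hQ : Q.PosSemidef := sum_qsymModulus_posSemidef A
  have hH : (Sᴴ * S).PosSemidef := posSemidef_conjTranspose_mul_self S
  have hsa : IsSelfAdjoint (Sᴴ * S) := hH.1
  have hspec : (spectrum ℝ (Sᴴ * S)).Finite := finite_real_spectrum
  have hcont : ∀ f : ℝ → ℝ, ContinuousOn f (spectrum ℝ (Sᴴ * S)) := fun f => hspec.continuousOn f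
  set g : ℝ → ℝ := fun t => t ^ ((p - 2) / 2)
  -- B = S |S|^(p-2) is the extremiser in Hölder duality: S*B = |S|^p up to the kernel convention,
  -- and tr |B|^q = tr |S|^p because (p - 1) q = p. The value of g at 0 is harmless, as g only
  -- enters multiplied by t.
  set B := S * cfc g (Sᴴ * S)
  have hgH : (cfc g (Sᴴ * S))ᴴ = cfc g (Sᴴ * S) := (cfc_predicate g (Sᴴ * S) : IsSelfAdjoint _)
  have e1 : (Sᴴ * B).trace.re = (Sᴴ * S).tracePow (p / 2) := by
    have : Sᴴ * B = cfc (fun t : ℝ => t * g t) (Sᴴ * S) := by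
      rw [← Matrix.mul_assoc, cfc_mul (fun t : ℝ => t) g _ (hcont _) (hcont _), cfc_id' ℝ _ hsa]
    rw [this, hH.1.re_trace_cfc, hH.1.tracePow_eq]
    refine Finset.sum_congr rfl fun i _ => ?_
    rcases (hH.eigenvalues_nonneg i).eq_or_lt with h0 | h0
    · rw [← h0, zero_mul, Real.zero_rpow (by positivity)]
    · rw [← Real.rpow_one_add' h0.le (by linarith)]
      congr 1; ring
  have e2 : (Bᴴ * B).tracePow (q / 2) = (Sᴴ * S).tracePow (p / 2) := by
    have : Bᴴ * B = cfc (fun t : ℝ => g t * (t * g t)) (Sᴴ * S) := by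
      rw [cfc_mul g _ _ (hcont _) (hcont _), cfc_mul (fun t : ℝ => t) g _ (hcont _) (hcont _),
        cfc_id' ℝ _ hsa, conjTranspose_mul, hgH]
      simp only [B, Matrix.mul_assoc]
    rw [this, hH.1.tracePow_cfc, hH.1.tracePow_eq]
    refine Finset.sum_congr rfl fun i _ => ?_
    rcases (hH.eigenvalues_nonneg i).eq_or_lt with h0 | h0
    · rw [← h0, zero_mul, mul_zero, Real.zero_rpow (by positivity), Real.zero_rpow (by positivity)]
    · rw [← Real.rpow_one_add' h0.le (by linarith), ← Real.rpow_add h0, ← Real.rpow_mul h0.le]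
      congr 1
      have := hpq.sub_one_mul_conj
      linear_combination this / 2
  have key := (re_trace_sum_conjTranspose_mul_le A B).trans
    (hQ.re_trace_mul_le_tracePow (qsymModulus_posSemidef B) hpq)
  rw [e1, tracePow_qsymModulus B hq0.le] at key
  have hB := h B
  rw [e2] at hB
  set τ := (Sᴴ * S).tracePow (p / 2)
  have hτ : 0 ≤ τ := hH.tracePow_nonneg _
  have hQp : 0 ≤ Q.tracePow p ^ (1 / p) := Real.rpow_nonneg (hQ.tracePow_nonneg p) _
  have key2 : τ ≤ Q.tracePow p ^ (1 / p) * (C ^ (1 / q) * τ ^ (1 / q)) := by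
    refine key.trans (mul_le_mul_of_nonneg_left ?_ hQp)
    rw [← Real.mul_rpow hC hτ]
    exact Real.rpow_le_rpow ((half_smul_add_posSemidef B).tracePow_nonneg _) hB (by positivity)
  -- For τ > 0, dividing by τ^(1/q) leaves τ^(1/p), the norm of S.
  rcases hτ.eq_or_lt with h0 | h0
  · rw [← h0, Real.zero_rpow (by positivity)]
    exact mul_nonneg (Real.rpow_nonneg hC _) hQp
  · have hsplit : τ = τ ^ (1 / p) * τ ^ (1 / q) := by
      rw [← Real.rpow_add h0, one_div, one_div, hpq.inv_add_inv_eq_one, Real.rpow_one]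
    refine le_of_mul_le_mul_right ?_ (Real.rpow_pos_of_pos h0 (1 / q))
    rw [← hsplit]
    linarith

theorem tracePow_sum_le_of_le_two {n m : ℕ} {p : ℝ} (hp1 : 1 < p) (hp2 : p ≤ 2)
    (A : Fin m → Matrix (Fin n) (Fin n) ℂ) :
    ((∑ k, A k)ᴴ * ∑ k, A k).tracePow (p / 2) ^ (1 / p) ≤
      (∑ k, qsymModulus (A k)).tracePow p ^ (1 / p) := by
  have hpq := Real.HolderConjugate.conjExponent hp1
  have hq : 2 ≤ p.conjExponent := by
    rw [Real.conjExponent, le_div_iff₀ (by linarith)]; linarith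
  have := tracePow_sum_le_of_dual hpq zero_le_one
    (fun B => (tracePow_half_add_le_of_one_le B (by linarith)).trans (one_mul _).ge) A
  rwa [Real.one_rpow, one_mul] at this

theorem tracePow_sum_le_of_two_lt {n m : ℕ} {p : ℝ} (hp : 2 < p)
    (A : Fin m → Matrix (Fin n) (Fin n) ℂ) :
    ((∑ k, A k)ᴴ * ∑ k, A k).tracePow (p / 2) ^ (1 / p) ≤
      2 ^ (1 / 2 - 1 / p) * (∑ k, qsymModulus (A k)).tracePow p ^ (1 / p) := by
  have hpq := Real.HolderConjugate.conjExponent (by linarith : 1 < p)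
  have hq : p.conjExponent < 2 := by
    rw [Real.conjExponent, div_lt_iff₀ (by linarith)]; linarith
  have hq0 := hpq.symm.pos
  have := tracePow_sum_le_of_dual hpq (C := 2 ^ (1 - p.conjExponent / 2)) (by positivity)
    (fun B => tracePow_half_add_le_of_lt_one B (by linarith) (by linarith)) A
  rw [← Real.rpow_mul zero_le_two] at this
  -- With q conjugate to p, the exponent is (1 - q/2)/q = 1/q - 1/2 = 1/2 - 1/p.
  have e : (1 - p.conjExponent / 2) * (1 / p.conjExponent) = 1 / 2 - 1 / p := by
    have h1 : 1 / p + 1 / p.conjExponent = 1 := by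
      rw [one_div, one_div, hpq.inv_add_inv_eq_one]
    have h2 : (1 - p.conjExponent / 2) * (1 / p.conjExponent) = 1 / p.conjExponent - 1 / 2 := by
      field_simp
    rw [h2]
    linarith
  rwa [e] at this

end

/-! ### Schatten norms and the endpoint exponents -/

section

open Matrix Filter Topology
open scoped ComplexOrder Matrix.Norms.L2Operator

namespace Matrix

variable {n : Type*} [Fintype n] [DecidableEq n]

theorem IsHermitian.norm_eq_norm_eigenvalues {M : Matrix n n ℂ} (hM : M.IsHermitian) :
    ‖M‖ = ‖fun i => (hM.eigenvalues i : ℂ)‖ := by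
  conv_lhs => rw [hM.eq_mul_diagonal_mul]
  rw [← star_eq_conjTranspose, ← Unitary.coe_star, CStarRing.norm_mul_coe_unitary,
    CStarRing.norm_coe_unitary_mul, l2_opNorm_diagonal]

theorem norm_le_tracePow (X : Matrix n n ℂ) {p : ℝ} (hp : 0 < p) :
    ‖X‖ ≤ (Xᴴ * X).tracePow (p / 2) ^ (1 / p) := by
  have hH : (Xᴴ * X).PosSemidef := posSemidef_conjTranspose_mul_self X
  have hτ := hH.tracePow_nonneg (p / 2)
  refine le_of_sq_le_sq ?_ (Real.rpow_nonneg hτ _)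
  rw [sq, ← l2_opNorm_conjTranspose_mul_self, hH.1.norm_eq_norm_eigenvalues]
  refine (pi_norm_le_iff_of_nonneg (sq_nonneg _)).2 fun i => ?_
  rw [Complex.norm_real, Real.norm_of_nonneg (hH.eigenvalues_nonneg i), ← Real.rpow_mul_natCast hτ]
  have h1 : hH.1.eigenvalues i ^ (p / 2) ≤ (Xᴴ * X).tracePow (p / 2) := by
    rw [hH.1.tracePow_eq]
    exact Finset.single_le_sum (f := fun j => hH.1.eigenvalues j ^ (p / 2))
      (fun j _ => Real.rpow_nonneg (hH.eigenvalues_nonneg j) _) (Finset.mem_univ i)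
  have h2 := Real.rpow_le_rpow (Real.rpow_nonneg (hH.eigenvalues_nonneg i) _) h1
    (by positivity : 0 ≤ 1 / p * (2 : ℕ))
  rw [← Real.rpow_mul (hH.eigenvalues_nonneg i)] at h2
  have e : p / 2 * (1 / p * (2 : ℕ)) = 1 := by push_cast; field_simp
  rwa [e, Real.rpow_one] at h2

/-- With `norm_le_tracePow` this traps the Schatten norm between ‖X‖ and a multiple of it that tends
to 1 as p → ∞. The + 1 keeps the base nonzero in dimension 0, so that its power is continuous in the
exponent. -/
theorem tracePow_le_norm (X : Matrix n n ℂ) {p : ℝ} (hp : 0 < p) :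
    (Xᴴ * X).tracePow (p / 2) ^ (1 / p) ≤ ((Fintype.card n : ℝ) + 1) ^ (1 / p) * ‖X‖ := by
  have hH : (Xᴴ * X).PosSemidef := posSemidef_conjTranspose_mul_self X
  have hτ := hH.tracePow_nonneg (p / 2)
  have h1 : (Xᴴ * X).tracePow (p / 2) ≤ ((Fintype.card n : ℝ) + 1) * ‖X‖ ^ p := by
    rw [hH.1.tracePow_eq]
    refine (Finset.sum_le_card_nsmul _ _ (‖X‖ ^ p) fun i _ => ?_).trans ?_
    · have h2 : hH.1.eigenvalues i ≤ ‖X‖ ^ 2 := by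
        rw [sq, ← l2_opNorm_conjTranspose_mul_self, hH.1.norm_eq_norm_eigenvalues]
        have := norm_le_pi_norm (fun i => (hH.1.eigenvalues i : ℂ)) i
        rwa [Complex.norm_real, Real.norm_of_nonneg (hH.eigenvalues_nonneg i)] at this
      have h3 := Real.rpow_le_rpow (hH.eigenvalues_nonneg i) h2 (by positivity : 0 ≤ p / 2)
      rwa [← Real.rpow_natCast_mul (norm_nonneg X),
        show ((2 : ℕ) : ℝ) * (p / 2) = p by push_cast; ring] at h3
    · rw [nsmul_eq_mul, Finset.card_univ]
      exact mul_le_mul_of_nonneg_right (by linarith) (Real.rpow_nonneg (norm_nonneg _) _)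
  have h2 := Real.rpow_le_rpow hτ h1 (by positivity : 0 ≤ 1 / p)
  rwa [Real.mul_rpow (by positivity) (by positivity), ← Real.rpow_mul (norm_nonneg X),
    mul_one_div_cancel hp.ne', Real.rpow_one] at h2

theorem PosSemidef.continuousAt_tracePow {M : Matrix n n ℂ} (hM : M.PosSemidef) {p : ℝ}
    (hp : 0 < p) : ContinuousAt (fun p : ℝ => M.tracePow (p / 2) ^ (1 / p)) p := by
  have h1 : ContinuousAt (fun p : ℝ => M.tracePow (p / 2)) p := by
    simp only [hM.1.tracePow_eq]
    refine tendsto_finsetSum _ fun i _ => ?_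
    exact ContinuousAt.rpow continuousAt_const (continuousAt_id.div_const 2)
      (Or.inr (by simpa using hp))
  exact h1.rpow (continuousAt_const.div continuousAt_id hp.ne') (Or.inr (by simpa using hp))

theorem IsHermitian.tracePow_of_mul_self {P : Matrix n n ℂ} (hP : P.IsHermitian) (h : P * P = P)
    {r : ℝ} (hr : r ≠ 0) : P.tracePow r = P.trace.re := by
  have hP' : IsSelfAdjoint P := hP
  have hspec : (spectrum ℝ P).Finite := finite_real_spectrum
  have h2 : cfc (fun x : ℝ => x * x) P = cfc (fun x : ℝ => x) P := by
    rw [cfc_mul (fun x : ℝ => x) (fun x : ℝ => x) P (hspec.continuousOn _) (hspec.continuousOn _),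
      cfc_id' ℝ P hP', h]
  have h3 := (cfc_eq_cfc_iff_eqOn (R := ℝ) (hf := hspec.continuousOn _) (hg := hspec.continuousOn _)
    (ha := hP')).1 h2
  rw [tracePow]
  have h4 : cfc (fun x : ℝ => x ^ r) P = cfc (fun x : ℝ => x) P := by
    refine cfc_congr fun x hx => ?_
    have hx2 : x * x = x := h3 hx
    rcases eq_or_ne x 0 with rfl | h0
    · exact Real.zero_rpow hr
    · have : x = 1 := by simpa [h0] using hx2
      rw [this]; exact Real.one_rpow r
  rw [h4, cfc_id' ℝ P hP']

theorem IsHermitian.norm_of_mul_self {P : Matrix n n ℂ} (hP : P.IsHermitian) (h : P * P = P)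
    (h0 : P ≠ 0) : ‖P‖ = 1 := by
  have h1 := l2_opNorm_conjTranspose_mul_self P
  rw [hP.eq, h] at h1
  have h2 := norm_ne_zero_iff.2 h0
  field_simp at h1
  exact h1.symm

end Matrix

section schattenNorm

variable {n : ℕ}

theorem schattenNorm_top (X : Matrix (Fin n) (Fin n) ℂ) : schattenNorm ∞ X = ‖X‖ := by
  rw [schattenNorm, if_pos rfl]; rfl

theorem schattenNorm_of_ne_top {p : ℝ≥0∞} (hp : p ≠ ∞) (X : Matrix (Fin n) (Fin n) ℂ) :
    schattenNorm p X = (Xᴴ * X).tracePow (p.toReal / 2) ^ (1 / p.toReal) := by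
  rw [schattenNorm, if_neg hp, ← tracePow_eq_trace_rpow (CFC.abs_nonneg X), CFC.abs,
    star_eq_conjTranspose, tracePow_sqrt (nonneg_iff_posSemidef.2
      (posSemidef_conjTranspose_mul_self X)) ENNReal.toReal_nonneg]

/-- The case p = ∞, as the limit p → ∞ of the bounds for finite p > 2. -/
theorem norm_sum_le_sqrt_two_mul {m : ℕ} (A : Fin m → Matrix (Fin n) (Fin n) ℂ) :
    ‖∑ k, A k‖ ≤ 2 ^ (1 / 2 : ℝ) * ‖∑ k, qsymModulus (A k)‖ := by
  have hQ := sum_qsymModulus_posSemidef A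
  have hb : ∀ p : ℝ, 2 < p → ‖∑ k, A k‖ ≤
      2 ^ (1 / 2 - 1 / p) * (((n : ℝ) + 1) ^ (1 / p) * ‖∑ k, qsymModulus (A k)‖) := by
    intro p hp
    have hp0 : 0 < p := by linarith
    refine ((norm_le_tracePow _ hp0).trans (tracePow_sum_le_of_two_lt hp A)).trans ?_
    refine mul_le_mul_of_nonneg_left ?_ (by positivity)
    rw [← hQ.tracePow_conjTranspose_mul_self hp0.le]
    simpa using tracePow_le_norm (∑ k, qsymModulus (A k)) hp0
  have hlim : Tendsto (fun p : ℝ => 1 / p) atTop (𝓝 0) := by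
    simpa only [one_div] using tendsto_inv_atTop_zero
  have hn : (n : ℝ) + 1 ≠ 0 := by positivity
  have hc : Continuous fun u : ℝ =>
      (2 : ℝ) ^ (1 / 2 - u) * (((n : ℝ) + 1) ^ u * ‖∑ k, qsymModulus (A k)‖) :=
    (continuous_const.rpow (continuous_const.sub continuous_id) fun _ => Or.inl two_ne_zero).mul
      ((continuous_const.rpow continuous_id fun _ => Or.inl hn).mul continuous_const)
  have hlim2 := (hc.tendsto 0).comp hlim
  rw [sub_zero, Real.rpow_zero, one_mul] at hlim2
  exact ge_of_tendsto hlim2 ((eventually_gt_atTop 2).mono hb)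

theorem schattenNorm_sum_le_of_le_two {m : ℕ} {p : ℝ≥0∞} (hp1 : 1 ≤ p) (hp2 : p ≤ 2)
    (A : Fin m → Matrix (Fin n) (Fin n) ℂ) :
    schattenNorm p (∑ k, A k) ≤ schattenNorm p (∑ k, qsymModulus (A k)) := by
  have hp : p ≠ ∞ := ne_top_of_le_ne_top ENNReal.ofNat_ne_top hp2
  have h1 : 1 ≤ p.toReal := by simpa using ENNReal.toReal_mono hp hp1
  have h2 : p.toReal ≤ 2 := by simpa using ENNReal.toReal_mono ENNReal.ofNat_ne_top hp2
  rw [schattenNorm_of_ne_top hp, schattenNorm_of_ne_top hp]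
  generalize p.toReal = r at h1 h2
  have hQ := sum_qsymModulus_posSemidef A
  have hb : ∀ s : ℝ, 1 < s → s ≤ 2 → ((∑ k, A k)ᴴ * ∑ k, A k).tracePow (s / 2) ^ (1 / s) ≤
      ((∑ k, qsymModulus (A k))ᴴ * ∑ k, qsymModulus (A k)).tracePow (s / 2) ^ (1 / s) := by
    intro s hs1 hs2
    rw [hQ.tracePow_conjTranspose_mul_self (by linarith)]
    exact tracePow_sum_le_of_le_two hs1 hs2 A
  -- At p = 1 the conjugate exponent is infinite and the duality argument does not apply; both sides
  -- are continuous in the exponent, so let s → 1+.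
  rcases h1.eq_or_lt with rfl | h1
  · refine le_of_tendsto_of_tendsto
      (((posSemidef_conjTranspose_mul_self _).continuousAt_tracePow one_pos).tendsto.mono_left
        (nhdsWithin_le_nhds (s := Set.Ioi 1)))
      (((posSemidef_conjTranspose_mul_self _).continuousAt_tracePow one_pos).tendsto.mono_left
        (nhdsWithin_le_nhds (s := Set.Ioi 1))) ?_
    filter_upwards [Ioc_mem_nhdsGT (one_lt_two : (1 : ℝ) < 2)] with s hs
    exact hb s hs.1 hs.2
  · exact hb r h1 h2

theorem schattenNorm_sum_le_of_two_le {m : ℕ} {p : ℝ≥0∞} (hp2 : 2 ≤ p)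
    (A : Fin m → Matrix (Fin n) (Fin n) ℂ) :
    schattenNorm p (∑ k, A k) ≤
      (2 : ℝ) ^ ((1 : ℝ) / 2 - (p⁻¹).toReal) * schattenNorm p (∑ k, qsymModulus (A k)) := by
  rcases eq_or_ne p ∞ with rfl | hp
  · simpa [schattenNorm_top] using norm_sum_le_sqrt_two_mul A
  rcases hp2.eq_or_lt with rfl | hlt
  · have := schattenNorm_sum_le_of_le_two one_le_two le_rfl A
    simpa using this
  have h2 : 2 < p.toReal := by
    simpa using (ENNReal.toReal_lt_toReal ENNReal.ofNat_ne_top hp).2 hlt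
  rw [schattenNorm_of_ne_top hp, schattenNorm_of_ne_top hp,
    (sum_qsymModulus_posSemidef A).tracePow_conjTranspose_mul_self (by linarith),
    ENNReal.toReal_inv, ← one_div]
  exact tracePow_sum_le_of_two_lt h2 A

/-! ### Extremal examples and sharpness -/

theorem sum_single_zero {m : ℕ} (X : Matrix (Fin n) (Fin n) ℂ) :
    ∑ k, (Pi.single 0 X : Fin (m + 1) → Matrix (Fin n) (Fin n) ℂ) k = X := by
  simp

theorem sum_qsymModulus_single_zero {m : ℕ} (X : Matrix (Fin n) (Fin n) ℂ) :
    ∑ k, qsymModulus ((Pi.single 0 X : Fin (m + 1) → Matrix (Fin n) (Fin n) ℂ) k)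
      = qsymModulus X := by
  rw [Fin.sum_univ_succ]
  simp [qsymModulus_eq_sqrt]

theorem qsymModulus_one : qsymModulus (1 : Matrix (Fin n) (Fin n) ℂ) = 1 := by
  rw [qsymModulus_eq_sqrt]
  have : (1 / 2 : ℝ) • ((1 : Matrix (Fin n) (Fin n) ℂ)ᴴ * 1 + 1 * (1 : Matrix _ _ ℂ)ᴴ) = 1 := by
    rw [conjTranspose_one, Matrix.mul_one, ← two_smul ℝ, smul_smul]; norm_num
  rw [this, CFC.sqrt_one]

theorem schattenNorm_one_pos {p : ℝ≥0∞} (hp1 : 1 ≤ p) (hp : p ≠ ∞) (hn : 1 ≤ n) :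
    0 < schattenNorm p (1 : Matrix (Fin n) (Fin n) ℂ) := by
  have h1 : 1 ≤ p.toReal := by simpa using ENNReal.toReal_mono hp hp1
  rw [schattenNorm_of_ne_top hp, conjTranspose_one, Matrix.mul_one,
    isHermitian_one.tracePow_of_mul_self (Matrix.one_mul 1) (by linarith)]
  refine Real.rpow_pos_of_pos ?_ _
  have hn' : 0 < n := hn
  simpa using hn'

/-- For a partial isometry `X` with `X ^ 2 = 0` and one-dimensional range, the Schatten norms of
`X` and of its quadratic symmetric modulus are in the extremal ratio. -/
theorem schattenNorm_rank_one {X : Matrix (Fin n) (Fin n) ℂ} (hXX : X * X = 0)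
    (hX : X * Xᴴ * X = X) (htr : (Xᴴ * X).trace = 1) {p : ℝ≥0∞} (hp2 : 2 ≤ p) :
    schattenNorm p X = 1 ∧
      schattenNorm p (qsymModulus X) = 2 ^ ((p⁻¹).toReal - 1 / 2) := by
  have hXX' : Xᴴ * Xᴴ = 0 := by rw [← conjTranspose_mul, hXX, conjTranspose_zero]
  have hX' : Xᴴ * X * Xᴴ = Xᴴ := by
    have := congrArg conjTranspose hX
    rwa [conjTranspose_mul, conjTranspose_mul, conjTranspose_conjTranspose, ← Matrix.mul_assoc]
      at this
  have hP : (Xᴴ * X).IsHermitian := isHermitian_conjTranspose_mul_self X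
  have hPP : Xᴴ * X * (Xᴴ * X) = Xᴴ * X := by rw [← Matrix.mul_assoc, hX']
  have hPS : (Xᴴ * X + X * Xᴴ).PosSemidef :=
    (posSemidef_conjTranspose_mul_self X).add (posSemidef_self_mul_conjTranspose X)
  -- X² = 0 makes the projections X*X and XX* mutually orthogonal, so their sum is a projection, of
  -- trace 2, and |X|_qsym² is half of it.
  have hRR : (Xᴴ * X + X * Xᴴ) * (Xᴴ * X + X * Xᴴ) = Xᴴ * X + X * Xᴴ := by
    have h1 : Xᴴ * X * (X * Xᴴ) = 0 := by
      rw [Matrix.mul_assoc, ← Matrix.mul_assoc X X, hXX, Matrix.zero_mul, Matrix.mul_zero]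
    have h2 : X * Xᴴ * (Xᴴ * X) = 0 := by
      rw [Matrix.mul_assoc, ← Matrix.mul_assoc Xᴴ Xᴴ, hXX', Matrix.zero_mul, Matrix.mul_zero]
    have h3 : X * Xᴴ * (X * Xᴴ) = X * Xᴴ := by rw [← Matrix.mul_assoc, hX]
    rw [Matrix.mul_add, Matrix.add_mul, Matrix.add_mul, hPP, h1, h2, h3, add_zero, zero_add]
  have htR : (Xᴴ * X + X * Xᴴ).trace = 2 := by
    rw [trace_add, trace_mul_comm X, htr]; norm_num
  have hP0 : Xᴴ * X ≠ 0 := fun h => by rw [h] at htr; simp at htr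
  have hR0 : Xᴴ * X + X * Xᴴ ≠ 0 := fun h => by rw [h] at htR; simp at htR
  have hq : (qsymModulus X)ᴴ * qsymModulus X = (1 / 2 : ℝ) • (Xᴴ * X + X * Xᴴ) := by
    rw [(qsymModulus_posSemidef X).1.eq, qsymModulus_eq_sqrt, CFC.sqrt_mul_sqrt_self _
      (nonneg_iff_posSemidef.2 (half_smul_add_posSemidef X))]
  rcases eq_or_ne p ∞ with rfl | hp
  · rw [schattenNorm_top, schattenNorm_top]
    constructor
    · have := l2_opNorm_conjTranspose_mul_self X
      rw [hP.norm_of_mul_self hPP hP0] at this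
      nlinarith [norm_nonneg X]
    · have := l2_opNorm_conjTranspose_mul_self (qsymModulus X)
      rw [hq, norm_smul, hPS.1.norm_of_mul_self hRR hR0, mul_one, ← sq] at this
      rw [← Real.sqrt_sq (norm_nonneg (qsymModulus X)), ← this, Real.sqrt_eq_rpow]
      simp only [ENNReal.inv_top, ENNReal.toReal_zero, zero_sub, one_div, norm_inv,
        Real.norm_ofNat]
      rw [Real.inv_rpow zero_le_two, Real.rpow_neg zero_le_two]
  · have h2 : 2 ≤ p.toReal := by simpa using ENNReal.toReal_mono hp hp2
    have hr : p.toReal / 2 ≠ 0 := by positivity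
    have hr' : p.toReal ≠ 0 := by positivity
    rw [schattenNorm_of_ne_top hp, schattenNorm_of_ne_top hp, hq, hP.tracePow_of_mul_self hPP hr,
      hPS.tracePow_smul (by norm_num), hPS.1.tracePow_of_mul_self hRR hr, htr, htR]
    refine ⟨by simp, ?_⟩
    rw [one_div (2 : ℝ), Real.inv_rpow zero_le_two, ← Real.rpow_neg zero_le_two, Complex.re_ofNat,
      ← Real.rpow_add_one two_ne_zero, ← Real.rpow_mul zero_le_two, ENNReal.toReal_inv]
    congr 1
    field_simp
    ring

end schattenNorm

end

theorem mainTheorem8 (p : ℝ≥0∞) (hp : 1 ≤ p) :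
    (p ≤ 2 →
      (∀ (m n : ℕ) (A : Fin m → Matrix (Fin n) (Fin n) ℂ),
        schattenNorm p (∑ k, A k) ≤ schattenNorm p (∑ k, qsymModulus (A k))) ∧
      (∀ m n : ℕ, 1 ≤ m → 1 ≤ n → ∀ c : ℝ,
        (∀ A : Fin m → Matrix (Fin n) (Fin n) ℂ,
          schattenNorm p (∑ k, A k) ≤ c * schattenNorm p (∑ k, qsymModulus (A k))) →
        1 ≤ c)) ∧
    (2 ≤ p →
      (∀ (m n : ℕ) (A : Fin m → Matrix (Fin n) (Fin n) ℂ),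
        schattenNorm p (∑ k, A k) ≤
          (2 : ℝ) ^ ((1 : ℝ) / 2 - (p⁻¹).toReal) * schattenNorm p (∑ k, qsymModulus (A k))) ∧
      (∀ m n : ℕ, 1 ≤ m → 2 ≤ n → ∀ c : ℝ,
        (∀ A : Fin m → Matrix (Fin n) (Fin n) ℂ,
          schattenNorm p (∑ k, A k) ≤ c * schattenNorm p (∑ k, qsymModulus (A k))) →
        (2 : ℝ) ^ ((1 : ℝ) / 2 - (p⁻¹).toReal) ≤ c)) := by
  refine ⟨fun hp2 => ⟨fun m n A => schattenNorm_sum_le_of_le_two hp hp2 A, ?_⟩,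
    fun hp2 => ⟨fun m n A => schattenNorm_sum_le_of_two_le hp2 A, ?_⟩⟩
  · rintro (_ | m) n hm hn c h
    · omega
    -- One identity matrix and zeros otherwise: here the two sides of the norm inequality coincide.
    have h1 := h (Pi.single 0 1)
    rw [sum_single_zero, sum_qsymModulus_single_zero, qsymModulus_one] at h1
    have h2 := schattenNorm_one_pos hp (ne_top_of_le_ne_top ENNReal.ofNat_ne_top hp2) hn
    exact le_of_mul_le_mul_right (by rwa [one_mul]) h2
  · rintro (_ | m) n hm hn c h
    · omega
    obtain ⟨n, rfl⟩ := Nat.exists_eq_add_of_le' hn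
    -- The matrix unit E₀₁ is a rank-one partial isometry with square zero; this is where n ≥ 2 is
    -- needed.
    have h1 := h (Pi.single 0 (Matrix.single 0 1 1))
    rw [sum_single_zero, sum_qsymModulus_single_zero] at h1
    obtain ⟨e1, e2⟩ := schattenNorm_rank_one (X := Matrix.single (0 : Fin (n + 2)) 1 (1 : ℂ))
      (by simp) (by simp) (by simp) hp2
    rw [e1, e2, ← neg_sub, Real.rpow_neg zero_le_two, ← div_eq_mul_inv, le_div_iff₀ (by positivity),
      one_mul] at h1
    exact h1
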